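/- Let $K>0$. For $\theta>0$ consider the integral equation $$y(s)=\sqrt{\tfrac{2s}{\pi}}\,\theta-K\int_0^s\frac{y^2(u)}{\sqrt{2\pi(s-u)}}\,du. \qquad (*)$$ A nonnegative solution of $(*)$ on $[0,1]$ (respectively on $[0,\infty)$) is a function $y\ge 0$ on that interval such that, for every $s$ in the interval, $u\mapsto y^2(u)/\sqrt{2\pi(s-u)}$ is integrable on $(0,s)$ and $(*)$ holds. (1) For every $\theta>0$, $(*)$ has a unique nonnegative solution $\Lambda(\cdot,\theta)$ on $[0,1]$. The function $s\mapsto\Lambda(s,\theta)$ is continuous and non-decreasing on $[0,1]$, differentiable on $(0,1]$ (one-sidedly at $s=1$), and $\Lambda(s,\theta)\le\sqrt{\theta/K}$ for all $s\in[0,1]$. (2) For every $\theta>0$, $\Lambda(\cdot,\theta)$ extends to a continuous function on $[0,\infty)$, again denoted by $\Lambda(\cdot,\theta)$, which is the unique non-decreasing nonnegative solution of $(*)$ on $[0,\infty)$. For all $s>0$ and $\theta>0$, $$\Lambda(s,\theta)=\frac{1}{\sqrt{s}}\,\Lambda(1,\theta s),$$ and $\lim_{s\to\infty}\Lambda(s,1)=1/\sqrt{K}$.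 -/

import Mathlib

open Set Filter Topology MeasureTheory

/-- `y` is a nonnegative solution, for all `s` in the time set `S`, of
`y(s) = √(2s/π) θ - K ∫₀ˢ y(u)² / √(2π(s-u)) du`.
It is used for `S = [0,1]` and `S = [0,∞)`, so that `S` contains `[0,s]` whenever it contains `s`
and the values of `y` outside `S` are irrelevant. The integral is required to exist
at every `s` in `S`. -/
structure IsNonnegSolutionOn (K θ : ℝ) (S : Set ℝ) (y : ℝ → ℝ) : Prop where
  nonneg : ∀ s ∈ S, 0 ≤ y s
  integrable : ∀ s ∈ S,
    IntervalIntegrable (fun u => y u ^ 2 / √(2 * Real.pi * (s - u))) volume 0 s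
  eqn : ∀ s ∈ S,
    y s = √(2 * s / Real.pi) * θ - K * ∫ u in (0 : ℝ)..s, y u ^ 2 / √(2 * Real.pi * (s - u))

/-!
Write `k(t) = 1 / √(2πt)` for `t > 0`. Since `(k * 1)(s) = √(2s/π)`, the equation reads
`y = k * (θ - K y²)`.

*Existence.* Adding `l (k * y)` to both sides makes the nonlinearity increasing: with
`M = √(θ/K)` and `l = 2KM`, the function `g(x) = (θ + l x - K x²) / l = M - (M - x)² / (2M)` is
increasing on `[0, M]` and bounded there by `g(M) = M`, and the equation becomes
`y + l (k * y) = l (k * g(y))`. Inverting the left side means writing `y = r * g(y)`, where `r`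
solves the resolvent equation `r + l (k * r) = l k`. What matters is that `r ≥ 0` and `∫ r ≤ 1`
(`resolvent_equation`, `lconvolution_resolvent_step_le`): then `y ↦ r * g(y)` is order preserving
on nondecreasing functions of time, and its least fixed point is a nondecreasing solution bounded
by `M` (`exists_lconvolution_solution`).
The resolvent is explicit. With `R(t) = l ∫₀^∞ k(t + v) exp(-l² v / 2) dv`, which is
`exp(l² t / 2) erfc(l √(t / 2))`, one has `R + l (k * R) = 1`, and `r = l k - (l² / 2) R` because
`k * k = 1/2`. Positivity of `r` holds because `k` is decreasing. All these functions are
nonnegative, so the algebra is done with `ℝ≥0∞`-valued functions on `ℝ` that vanish on `(-∞, 0]`,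
where convolution is associative without integrability conditions.

*Regularity.* Since `y` is nondecreasing so is `k * y²`, hence
`0 ≤ y(t) - y(s) ≤ θ (√(2t/π) - √(2s/π))` for `s ≤ t`. Together with `y(s) ≤ θ √(2s/π)` this makes
`y²`, extended by zero to the left, Lipschitz on all of `ℝ` (`IsMonotoneSolution.lipschitzWith_sq`).
So `y` is continuous, and `k * y²` can be differentiated under the integral sign.

*Uniqueness* (`eqOn_of_isNonnegSolutionOn`). Nonnegative solutions on `[0, T]` are bounded by
`θ √(2T/π)`, so `y ↦ K (k * y²)` is Lipschitz along them, and is a contraction for the weighted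
norm `sup |y(s)| exp(-l² s / 2)` with `l` large. The scaling relation follows from uniqueness.

*Limit.* If `L` is the limit of `y`, then `√(2s/π) (1 - K L²) ≤ y(s)` stays bounded as `s → ∞`,
which forces `K L² ≥ 1`.
-/

namespace SqrtVolterra

open scoped ENNReal

noncomputable section

/-! ### The kernel, the unit step and the convolution on the half line -/

/-- The kernel `k(t) = 1 / √(2πt)` for `t > 0`. It is zero for `t ≤ 0`, as `√` vanishes on
nonpositive numbers and `1 / 0 = 0`. -/
def kern (t : ℝ) : ℝ≥0∞ := ENNReal.ofReal (1 / √(2 * Real.pi * t))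

/-- The indicator of `(0, ∞)`: the constant function `1` on the half line. -/
def step : ℝ → ℝ≥0∞ := (Ioi 0).indicator 1

@[fun_prop]
lemma measurable_kern : Measurable kern := by unfold kern; fun_prop

@[fun_prop]
lemma measurable_step : Measurable step := measurable_one.indicator measurableSet_Ioi

lemma kern_of_nonpos {t : ℝ} (ht : t ≤ 0) : kern t = 0 := by
  have : 2 * Real.pi * t ≤ 0 := mul_nonpos_of_nonneg_of_nonpos (by positivity) ht
  simp [kern, Real.sqrt_eq_zero_of_nonpos this]

lemma step_of_nonpos {t : ℝ} (ht : t ≤ 0) : step t = 0 := by simp [step, ht]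

lemma step_of_pos {t : ℝ} (ht : 0 < t) : step t = 1 := by simp [step, ht]

lemma step_le_one (t : ℝ) : step t ≤ 1 := indicator_le_self' (by simp) t

lemma monotone_step : Monotone step := fun s t h => by
  rcases le_or_gt s 0 with hs | hs
  · simp [step_of_nonpos hs]
  · simp [step_of_pos hs, step_of_pos (hs.trans_le h)]

lemma lconvolution_add {f g h : ℝ → ℝ≥0∞} (hf : Measurable f) (hg : Measurable g) (x : ℝ) :
    (f ⋆ₗ (fun t => g t + h t)) x = (f ⋆ₗ g) x + (f ⋆ₗ h) x := by
  simp only [lconvolution_def, mul_add]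
  exact lintegral_add_left (by fun_prop) _

lemma lconvolution_const_mul {f g : ℝ → ℝ≥0∞} (hf : Measurable f) (hg : Measurable g)
    (c : ℝ≥0∞) (x : ℝ) : (f ⋆ₗ (fun t => c * g t)) x = c * (f ⋆ₗ g) x := by
  simp only [lconvolution_def]
  rw [← lintegral_const_mul _ (by fun_prop)]
  exact lintegral_congr fun y => by ring

lemma const_mul_lconvolution {f g : ℝ → ℝ≥0∞} (hf : Measurable f) (hg : Measurable g)
    (c : ℝ≥0∞) (x : ℝ) : ((fun t => c * f t) ⋆ₗ g) x = c * (f ⋆ₗ g) x := by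
  simp only [lconvolution_def, mul_assoc]
  exact lintegral_const_mul _ (by fun_prop)

lemma lconvolution_mono {f g h : ℝ → ℝ≥0∞} (hgh : ∀ t, g t ≤ h t) (x : ℝ) :
    (f ⋆ₗ g) x ≤ (f ⋆ₗ h) x :=
  lintegral_mono fun y => by dsimp only; gcongr; exact hgh _

lemma lconvolution_of_nonpos {f g : ℝ → ℝ≥0∞} (hf : ∀ t ≤ 0, f t = 0) (hg : ∀ t ≤ 0, g t = 0)
    {x : ℝ} (hx : x ≤ 0) : (f ⋆ₗ g) x = 0 := by
  rw [lconvolution_def]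
  refine (lintegral_congr fun y => ?_).trans lintegral_zero
  rcases le_or_gt y 0 with hy | hy
  · simp [hf y hy]
  · simp [hg (-y + x) (by linarith)]

lemma monotone_lconvolution {f g : ℝ → ℝ≥0∞} (hg : Monotone g) : Monotone (f ⋆ₗ g) :=
  fun s t h => lintegral_mono fun y => by dsimp only; gcongr; exact hg (by linarith)

/-- Up to scaling, the integrand of `(k * k)(x)` is the density of the arcsine law on `[0, x]`. -/
lemma kern_mul_kern_eq_betaPDF {x : ℝ} (hx : 0 < x) (y : ℝ) :
    kern y * kern (-y + x) =
      ENNReal.ofReal (1 / (2 * x)) * ProbabilityTheory.betaPDF (1 / 2) (1 / 2) (x⁻¹ * y) := by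
  rcases le_or_gt y 0 with hy | hy
  · rw [kern_of_nonpos hy, ProbabilityTheory.betaPDF_eq_zero_of_nonpos]
    · simp
    · exact mul_nonpos_of_nonneg_of_nonpos (by positivity) hy
  rcases le_or_gt x y with hxy | hxy
  · rw [kern_of_nonpos (t := -y + x) (by linarith), ProbabilityTheory.betaPDF_eq_zero_of_one_le]
    · simp
    · rw [← div_eq_inv_mul, le_div_iff₀ hx]; linarith
  have h1 : 0 < x⁻¹ * y := by positivity
  have h2 : x⁻¹ * y < 1 := by rw [← div_eq_inv_mul, div_lt_one hx]; exact hxy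
  have hb : ProbabilityTheory.beta (1 / 2) (1 / 2) = Real.pi := by
    rw [ProbabilityTheory.beta, Real.Gamma_one_half_eq]
    norm_num
    exact Real.mul_self_sqrt Real.pi_pos.le
  have hxy' : 0 < x - y := by linarith
  rw [ProbabilityTheory.betaPDF_of_pos_lt_one h1 h2, hb, kern, kern,
    ← ENNReal.ofReal_mul (by positivity), ← ENNReal.ofReal_mul (by positivity)]
  congr 1
  have e1 : (1 / 2 - 1 : ℝ) = -(1 / 2) := by norm_num
  have e2 : 1 - x⁻¹ * y = x⁻¹ * (x - y) := by field_simp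
  rw [e1, e2, Real.rpow_neg (by positivity), Real.rpow_neg (by positivity),
    ← Real.sqrt_eq_rpow, ← Real.sqrt_eq_rpow, neg_add_eq_sub,
    Real.sqrt_mul (x := 2 * Real.pi) (by positivity),
    Real.sqrt_mul (x := 2 * Real.pi) (by positivity),
    Real.sqrt_mul (x := x⁻¹) (by positivity), Real.sqrt_mul (x := x⁻¹) (by positivity),
    Real.sqrt_inv]
  have := Real.sqrt_pos.2 hx
  have := Real.sqrt_pos.2 hy
  have := Real.sqrt_pos.2 hxy'
  have hp : √(2 * Real.pi) ^ 2 = 2 * Real.pi := Real.sq_sqrt (by positivity)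
  have hx2 : √x ^ 2 = x := Real.sq_sqrt hx.le
  have : 0 < √(2 * Real.pi) := by positivity
  field_simp
  rw [hp, hx2]

lemma kern_lconvolution_kern (x : ℝ) : (kern ⋆ₗ kern) x = 2⁻¹ * step x := by
  rcases le_or_gt x 0 with hx | hx
  · rw [lconvolution_of_nonpos (fun _ => kern_of_nonpos) (fun _ => kern_of_nonpos) hx,
      step_of_nonpos hx, mul_zero]
  have hm : Measurable (ProbabilityTheory.betaPDF (1 / 2) (1 / 2)) := by
    unfold ProbabilityTheory.betaPDF; fun_prop
  rw [lconvolution_def, lintegral_congr (kern_mul_kern_eq_betaPDF hx),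
    lintegral_const_mul _ (by fun_prop), step_of_pos hx]
  have := Real.map_volume_mul_left (a := x⁻¹) (by positivity)
  rw [← lintegral_map (μ := volume) hm (measurable_const_mul x⁻¹), this, lintegral_smul_measure,
    ProbabilityTheory.lintegral_betaPDF_eq_one (by norm_num) (by norm_num), smul_eq_mul, mul_one,
    mul_one, ← ENNReal.ofReal_mul (by positivity), inv_inv, abs_of_pos hx]
  rw [show 1 / (2 * x) * x = 2⁻¹ by field_simp, ENNReal.ofReal_inv_of_pos (by norm_num)]
  simp

/-- The Laplace transform of `k`, at `l² / 2`. -/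
lemma integral_exp_div_sqrt {l : ℝ} (hl : 0 < l) :
    ∫ t, Real.exp (-(l ^ 2 / 2 * t)) / √(2 * Real.pi * t) = 1 / l := by
  rw [← setIntegral_eq_integral_of_forall_compl_eq_zero (s := Ioi 0)]
  · have := Real.integral_rpow_mul_exp_neg_mul_Ioi (a := 1 / 2) (r := l ^ 2 / 2) (by norm_num)
      (by positivity)
    calc _ = ∫ t in Ioi (0 : ℝ), (1 / √(2 * Real.pi)) *
          (t ^ ((1 : ℝ) / 2 - 1) * Real.exp (-(l ^ 2 / 2 * t))) := by
          refine setIntegral_congr_fun measurableSet_Ioi fun t (ht : 0 < t) => ?_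
          rw [show (1 / 2 - 1 : ℝ) = -(1 / 2) by norm_num, Real.rpow_neg ht.le,
            ← Real.sqrt_eq_rpow, Real.sqrt_mul (by positivity)]
          field_simp
      _ = _ := by
          rw [integral_const_mul, this, Real.Gamma_one_half_eq, ← Real.sqrt_eq_rpow,
            one_div_div, Real.sqrt_div (by norm_num), Real.sqrt_sq hl.le,
            Real.sqrt_mul (by norm_num)]
          field_simp
  · intro t ht
    have : 2 * Real.pi * t ≤ 0 :=
      mul_nonpos_of_nonneg_of_nonpos (by positivity) (by simpa using ht)
    simp [Real.sqrt_eq_zero_of_nonpos this]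

lemma integrable_exp_div_sqrt {l : ℝ} (hl : 0 < l) :
    Integrable fun t => Real.exp (-(l ^ 2 / 2 * t)) / √(2 * Real.pi * t) := by
  by_contra h
  have := integral_exp_div_sqrt hl
  rw [integral_undef h] at this
  have : 0 < 1 / l := by positivity
  linarith

lemma lintegral_kern_mul_exp {l : ℝ} (hl : 0 < l) :
    ∫⁻ t, kern t * ENNReal.ofReal (Real.exp (-(l ^ 2 / 2 * t))) = ENNReal.ofReal (1 / l) := by
  rw [← integral_exp_div_sqrt hl, ofReal_integral_eq_lintegral_ofReal (integrable_exp_div_sqrt hl)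
    (ae_of_all _ fun t => by positivity)]
  refine lintegral_congr fun t => ?_
  rw [kern, ← ENNReal.ofReal_mul (by positivity)]
  congr 1
  ring

/-! ### The resolvent of the kernel -/

/-- The function `exp(l² t / 2)` on the half line. -/
def expStep (l t : ℝ) : ℝ≥0∞ := step t * ENNReal.ofReal (Real.exp (l ^ 2 / 2 * t))

/-- The function `R(t) = l ∫₀^∞ k(t + v) exp(-l² v / 2) dv` on the half line, that is
`exp(l² t / 2) erfc(l √(t / 2))`. It is the solution of `R + l (k * R) = 1`. -/
def relax (l t : ℝ) : ℝ≥0∞ :=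
  step t * (ENNReal.ofReal l *
    ∫⁻ v, step v * (kern (t + v) * ENNReal.ofReal (Real.exp (-(l ^ 2 / 2 * v)))))

/-- The resolvent `r = l k - (l² / 2) R` of the kernel `l k`. The truncated subtraction of `ℝ≥0∞`
is a true one here, see `resolvent_add_relax`. -/
def resolvent (l t : ℝ) : ℝ≥0∞ :=
  ENNReal.ofReal l * kern t - ENNReal.ofReal (l ^ 2 / 2) * relax l t

@[fun_prop]
lemma measurable_expStep (l : ℝ) : Measurable (expStep l) := by
  unfold expStep; fun_prop

@[fun_prop]
lemma measurable_relax (l : ℝ) : Measurable (relax l) := by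
  unfold relax
  have : Measurable fun t => ∫⁻ v, step v * (kern (t + v) *
      ENNReal.ofReal (Real.exp (-(l ^ 2 / 2 * v)))) :=
    Measurable.lintegral_prod_right (by fun_prop)
  fun_prop

@[fun_prop]
lemma measurable_resolvent (l : ℝ) : Measurable (resolvent l) := by
  unfold resolvent; fun_prop

lemma expStep_ne_top (l t : ℝ) : expStep l t ≠ ∞ :=
  ENNReal.mul_ne_top ((step_le_one t).trans_lt ENNReal.one_lt_top).ne ENNReal.ofReal_ne_top

lemma expStep_of_nonpos (l : ℝ) {t : ℝ} (ht : t ≤ 0) : expStep l t = 0 := by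
  simp [expStep, step_of_nonpos ht]

lemma relax_of_nonpos (l : ℝ) {t : ℝ} (ht : t ≤ 0) : relax l t = 0 := by
  simp [relax, step_of_nonpos ht]

lemma resolvent_of_nonpos (l : ℝ) {t : ℝ} (ht : t ≤ 0) : resolvent l t = 0 := by
  simp [resolvent, kern_of_nonpos ht]

/-- Splitting the Laplace integral of `k` at `t`: the part over `(0, t)` is the convolution, the
part over `(t, ∞)` is `R`. -/
lemma relax_add_lconvolution_expStep {l : ℝ} (hl : 0 < l) (t : ℝ) :
    relax l t + ENNReal.ofReal l * (kern ⋆ₗ expStep l) t = expStep l t := by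
  rcases le_or_gt t 0 with ht | ht
  · rw [relax_of_nonpos l ht, expStep_of_nonpos l ht, lconvolution_of_nonpos
      (fun _ => kern_of_nonpos) (fun _ => expStep_of_nonpos l) ht]
    simp
  have hshift : ∫⁻ v, step v * (kern (t + v) * ENNReal.ofReal (Real.exp (-(l ^ 2 / 2 * v)))) =
      ∫⁻ u, step (u - t) * (kern u * ENNReal.ofReal (Real.exp (-(l ^ 2 / 2 * (u - t))))) := by
    rw [← lintegral_sub_right_eq_self _ t]
    simp
  have hcore : (∫⁻ u, step (u - t) * (kern u *
        ENNReal.ofReal (Real.exp (-(l ^ 2 / 2 * (u - t)))))) + (kern ⋆ₗ expStep l) t =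
      ∫⁻ u, ENNReal.ofReal (Real.exp (l ^ 2 / 2 * t)) *
        (kern u * ENNReal.ofReal (Real.exp (-(l ^ 2 / 2 * u)))) := by
    rw [lconvolution_def, ← lintegral_add_left (by fun_prop)]
    refine lintegral_congr_ae ?_
    filter_upwards [Measure.ae_ne volume t] with u hu
    have he : ENNReal.ofReal (Real.exp (l ^ 2 / 2 * t)) *
        (kern u * ENNReal.ofReal (Real.exp (-(l ^ 2 / 2 * u)))) =
        kern u * ENNReal.ofReal (Real.exp (l ^ 2 / 2 * (t - u))) := by
      rw [mul_left_comm, ← ENNReal.ofReal_mul (by positivity), ← Real.exp_add]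
      congr 3; ring
    rw [he, expStep]
    rcases lt_or_gt_of_ne hu with h | h
    · rw [step_of_nonpos (t := u - t) (by linarith), step_of_pos (t := -u + t) (by linarith),
        zero_mul, zero_add, one_mul, neg_add_eq_sub]
    · rw [step_of_pos (t := u - t) (by linarith), step_of_nonpos (t := -u + t) (by linarith),
        zero_mul, mul_zero, add_zero, one_mul]
      congr 3; ring_nf
  rw [relax, hshift, step_of_pos ht, one_mul, ← mul_add, hcore, lintegral_const_mul _ (by fun_prop),
    lintegral_kern_mul_exp hl, mul_left_comm, ← ENNReal.ofReal_mul hl.le,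
    mul_one_div_cancel hl.ne', ENNReal.ofReal_one, mul_one, expStep, step_of_pos ht, one_mul]

lemma step_add_lconvolution_expStep {l : ℝ} (hl : 0 < l) (t : ℝ) :
    step t + ENNReal.ofReal (l ^ 2 / 2) * (step ⋆ₗ expStep l) t = expStep l t := by
  rcases le_or_gt t 0 with ht | ht
  · rw [step_of_nonpos ht, expStep_of_nonpos l ht, lconvolution_of_nonpos
      (fun _ => step_of_nonpos) (fun _ => expStep_of_nonpos l) ht]
    simp
  have hint : ∫ u in (0 : ℝ)..t, Real.exp (l ^ 2 / 2 * u) =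
      (Real.exp (l ^ 2 / 2 * t) - 1) / (l ^ 2 / 2) := by
    rw [intervalIntegral.integral_comp_mul_left (f := Real.exp) (by positivity), integral_exp]
    simp [div_eq_inv_mul]
  have hpos : 0 ≤ (Real.exp (l ^ 2 / 2 * t) - 1) / (l ^ 2 / 2) :=
    div_nonneg (sub_nonneg.2 (Real.one_le_exp (by positivity))) (by positivity)
  have hconv : (step ⋆ₗ expStep l) t =
      ENNReal.ofReal ((Real.exp (l ^ 2 / 2 * t) - 1) / (l ^ 2 / 2)) := by
    rw [lconvolution_comm, lconvolution_def, ← hint, intervalIntegral.integral_of_le ht.le,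
      ofReal_integral_eq_lintegral_ofReal
        ((by fun_prop : Continuous fun u => Real.exp (l ^ 2 / 2 * u)).integrableOn_Ioc)
        (ae_of_all _ fun u => by positivity), ← lintegral_indicator measurableSet_Ioc]
    refine lintegral_congr_ae ?_
    filter_upwards [Measure.ae_ne volume t] with u hu
    rcases le_or_gt u 0 with h0 | h0
    · simp [expStep_of_nonpos l h0, h0]
    rcases lt_or_gt_of_ne hu with h | h
    · rw [indicator_of_mem (show u ∈ Ioc 0 t from ⟨h0, h.le⟩), expStep, step_of_pos h0,
        step_of_pos (t := -u + t) (by linarith), one_mul, mul_one]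
    · rw [indicator_of_notMem fun hh => absurd hh.2 (not_le.2 h),
        step_of_nonpos (t := -u + t) (by linarith), mul_zero]
  rw [hconv, ← ENNReal.ofReal_mul (by positivity), mul_div_cancel₀ _ (by positivity), expStep,
    step_of_pos ht, one_mul, ← ENNReal.ofReal_one, ← ENNReal.ofReal_add (by norm_num)]
  · congr 1; ring
  · exact sub_nonneg.2 (Real.one_le_exp (by positivity))

lemma ofReal_mul_ofReal_mul_half {l : ℝ} (hl : 0 ≤ l) :
    ENNReal.ofReal l * (ENNReal.ofReal l * 2⁻¹) = ENNReal.ofReal (l ^ 2 / 2) := by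
  rw [← ENNReal.ofReal_ofNat, ← ENNReal.ofReal_inv_of_pos (by norm_num),
    ← ENNReal.ofReal_mul hl, ← ENNReal.ofReal_mul hl]
  congr 1; ring

/-- The equation `l (k * R) + R = 1`. Convolving `R + l (k * E) = E` with `k` gives
`k * R + (l / 2) (1 * E) = k * E`, where `E(t) = exp(l² t / 2)`, and `1 * E` is known. -/
lemma lconvolution_relax_add_relax {l : ℝ} (hl : 0 < l) (t : ℝ) :
    ENNReal.ofReal l * (kern ⋆ₗ relax l) t + relax l t = step t := by
  set a := ENNReal.ofReal l with ha
  have hE := relax_add_lconvolution_expStep hl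
  have h1 : (kern ⋆ₗ relax l) t + a * (2⁻¹ * (step ⋆ₗ expStep l) t) = (kern ⋆ₗ expStep l) t := by
    have hkk : kern ⋆ₗ kern = fun x => 2⁻¹ * step x := funext kern_lconvolution_kern
    have h2 : 2⁻¹ * (step ⋆ₗ expStep l) t = (kern ⋆ₗ (kern ⋆ₗ expStep l)) t := by
      rw [lconvolution_assoc (by fun_prop) (by fun_prop) (by fun_prop), hkk,
        const_mul_lconvolution (by fun_prop) (by fun_prop)]
    have hm : Measurable (kern ⋆ₗ expStep l) :=
      measurable_lconvolution _ (by fun_prop) (by fun_prop)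
    rw [h2, ← lconvolution_const_mul (by fun_prop) hm,
      ← lconvolution_add (by fun_prop) (by fun_prop)]
    congr 1
    exact funext hE
  have hv : a * (a * 2⁻¹) = ENNReal.ofReal (l ^ 2 / 2) := ofReal_mul_ofReal_mul_half hl.le
  have h3 : a * (kern ⋆ₗ relax l) t + ENNReal.ofReal (l ^ 2 / 2) * (step ⋆ₗ expStep l) t
      = a * (kern ⋆ₗ expStep l) t := by
    rw [← h1, ← hv]; ring
  refine (ENNReal.add_left_inj (expStep_ne_top l t)).1 ?_
  calc a * (kern ⋆ₗ relax l) t + relax l t + expStep l t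
      = relax l t + (a * (kern ⋆ₗ relax l) t + ENNReal.ofReal (l ^ 2 / 2) * (step ⋆ₗ expStep l) t)
          + step t := by rw [← step_add_lconvolution_expStep hl t]; ring
    _ = step t + expStep l t := by rw [h3, ← hE t]; ring

/-- The inequality `(l² / 2) R ≤ l k`, which holds because `k` is decreasing, makes the
subtraction in the definition of the resolvent a true one. -/
lemma resolvent_add_relax {l : ℝ} (hl : 0 < l) (t : ℝ) :
    resolvent l t + ENNReal.ofReal (l ^ 2 / 2) * relax l t = ENNReal.ofReal l * kern t := by
  rw [resolvent]
  refine tsub_add_cancel_of_le ?_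
  rcases le_or_gt t 0 with ht | ht
  · simp [relax_of_nonpos l ht]
  have hk : ∀ v, 0 < v → kern (t + v) ≤ kern t := fun v hv => by
    unfold kern
    gcongr
    linarith
  have h1 : ∫⁻ v, step v * (kern (t + v) * ENNReal.ofReal (Real.exp (-(l ^ 2 / 2 * v)))) ≤
      kern t * ENNReal.ofReal (1 / (l ^ 2 / 2)) := by
    have hi : ∫ v in Ioi (0 : ℝ), Real.exp (-(l ^ 2 / 2) * v) = 1 / (l ^ 2 / 2) := by
      rw [integral_exp_mul_Ioi (by simp; positivity)]
      simp
    rw [← hi, ofReal_integral_eq_lintegral_ofReal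
      (integrableOn_exp_mul_Ioi (by simp; positivity) 0)
      (ae_of_all _ fun v => by positivity), ← lintegral_const_mul _ (by fun_prop),
      ← lintegral_indicator measurableSet_Ioi]
    refine lintegral_mono fun v => ?_
    rcases le_or_gt v 0 with hv | hv
    · simp [step_of_nonpos hv]
    · rw [step_of_pos hv, one_mul, indicator_of_mem (mem_Ioi.2 hv), neg_mul]
      gcongr
      exact hk v hv
  calc _ ≤ ENNReal.ofReal (l ^ 2 / 2) * (1 * (ENNReal.ofReal l *
        (kern t * ENNReal.ofReal (1 / (l ^ 2 / 2))))) := by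
        rw [relax]; gcongr; exact step_le_one t
    _ = ENNReal.ofReal (l ^ 2 / 2) * ENNReal.ofReal (1 / (l ^ 2 / 2)) *
        (ENNReal.ofReal l * kern t) := by ring
    _ = _ := by
        rw [← ENNReal.ofReal_mul (by positivity), mul_one_div_cancel (by positivity),
          ENNReal.ofReal_one, one_mul]

lemma lconvolution_relax_ne_top {l : ℝ} (hl : 0 < l) (t : ℝ) :
    ENNReal.ofReal l * (kern ⋆ₗ relax l) t ≠ ∞ := by
  refine ((le_self_add.trans (lconvolution_relax_add_relax hl t).le).trans
    (step_le_one t)).trans_lt ENNReal.one_lt_top |>.ne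

lemma const_mul_lconvolution_resolvent {l : ℝ} (hl : 0 < l) (t : ℝ) :
    ENNReal.ofReal l * (kern ⋆ₗ resolvent l) t = ENNReal.ofReal (l ^ 2 / 2) * relax l t := by
  have h1 : (kern ⋆ₗ resolvent l) t + ENNReal.ofReal (l ^ 2 / 2) * (kern ⋆ₗ relax l) t =
      ENNReal.ofReal l * (2⁻¹ * step t) := by
    rw [← kern_lconvolution_kern, ← lconvolution_const_mul (by fun_prop) (by fun_prop),
      ← lconvolution_const_mul (by fun_prop) (by fun_prop),
      ← lconvolution_add (by fun_prop) (by fun_prop)]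
    congr 1
    exact funext (resolvent_add_relax hl)
  have hfin : ENNReal.ofReal (l ^ 2 / 2) * (ENNReal.ofReal l * (kern ⋆ₗ relax l) t) ≠ ∞ :=
    ENNReal.mul_ne_top ENNReal.ofReal_ne_top (lconvolution_relax_ne_top hl t)
  refine (ENNReal.add_left_inj hfin).1 ?_
  calc _ = ENNReal.ofReal l * ((kern ⋆ₗ resolvent l) t +
        ENNReal.ofReal (l ^ 2 / 2) * (kern ⋆ₗ relax l) t) := by ring
    _ = (ENNReal.ofReal l * (ENNReal.ofReal l * 2⁻¹)) * step t := by rw [h1]; ring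
    _ = _ := by rw [ofReal_mul_ofReal_mul_half hl.le, ← lconvolution_relax_add_relax hl t]; ring

lemma resolvent_equation {l : ℝ} (hl : 0 < l) (t : ℝ) :
    resolvent l t + ENNReal.ofReal l * (kern ⋆ₗ resolvent l) t = ENNReal.ofReal l * kern t := by
  rw [const_mul_lconvolution_resolvent hl, resolvent_add_relax hl]

/-- The resolvent has mass at most one: `1 * r = 2 (k * k * r)` is a multiple of `k * R`. -/
lemma lconvolution_resolvent_step_le {l : ℝ} (hl : 0 < l) (t : ℝ) :
    (resolvent l ⋆ₗ step) t ≤ 1 := by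
  have hkk : kern ⋆ₗ kern = fun x => 2⁻¹ * step x := funext kern_lconvolution_kern
  have hm : Measurable (kern ⋆ₗ resolvent l) :=
      measurable_lconvolution _ (by fun_prop) (by fun_prop)
  have h1 : 2⁻¹ * (resolvent l ⋆ₗ step) t = (kern ⋆ₗ (kern ⋆ₗ resolvent l)) t := by
    rw [lconvolution_assoc (by fun_prop) (by fun_prop) (by fun_prop), hkk,
      const_mul_lconvolution (by fun_prop) (by fun_prop), lconvolution_comm]
  have h2 : ENNReal.ofReal l * (kern ⋆ₗ (kern ⋆ₗ resolvent l)) t =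
      ENNReal.ofReal (l ^ 2 / 2) * (kern ⋆ₗ relax l) t := by
    rw [← lconvolution_const_mul (by fun_prop) hm, ← lconvolution_const_mul (by fun_prop)
      (by fun_prop)]
    congr 1
    exact funext (const_mul_lconvolution_resolvent hl)
  have h3 : ENNReal.ofReal (l ^ 2 / 2) * (resolvent l ⋆ₗ step) t ≤
      ENNReal.ofReal (l ^ 2 / 2) * 1 := by
    calc _ = ENNReal.ofReal l * (ENNReal.ofReal l * (2⁻¹ * (resolvent l ⋆ₗ step) t)) := by
          rw [← ofReal_mul_ofReal_mul_half hl.le]; ring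
      _ = ENNReal.ofReal (l ^ 2 / 2) * (ENNReal.ofReal l * (kern ⋆ₗ relax l) t) := by
          rw [h1, h2]; ring
      _ ≤ _ := by
          gcongr
          exact (le_self_add.trans (lconvolution_relax_add_relax hl t).le).trans (step_le_one t)
  exact (ENNReal.mul_le_mul_iff_right (by simp; positivity) ENNReal.ofReal_ne_top).1 h3

/-! ### Existence of a monotone bounded solution -/

/-- The nonlinearity `g(x) = M - (M - x)² / (2M)`, frozen at its value `M` for `x ≥ M` so that it
is monotone on all of `ℝ≥0∞`. -/
def gain (M : ℝ) (v : ℝ≥0∞) : ℝ≥0∞ :=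
  ENNReal.ofReal (M - (M - (min v (ENNReal.ofReal M)).toReal) ^ 2 / (2 * M))

lemma monotone_gain {M : ℝ} (hM : 0 < M) : Monotone (gain M) := fun v w h => by
  have hle : (min v (ENNReal.ofReal M)).toReal ≤ (min w (ENNReal.ofReal M)).toReal :=
    ENNReal.toReal_mono ((min_le_right _ _).trans_lt ENNReal.ofReal_lt_top).ne
      (min_le_min_right _ h)
  have hw : (min w (ENNReal.ofReal M)).toReal ≤ M :=
    ENNReal.toReal_le_of_le_ofReal hM.le (min_le_right _ _)
  unfold gain
  gcongr

lemma gain_le {M : ℝ} (hM : 0 < M) (v : ℝ≥0∞) : gain M v ≤ ENNReal.ofReal M := by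
  unfold gain
  gcongr
  have : 0 ≤ (M - (min v (ENNReal.ofReal M)).toReal) ^ 2 / (2 * M) := by positivity
  linarith

/-- The identity `l g(x) + K x² = θ + l x` for `x ≤ M`, with `l = 2KM` and `θ = K M²`. -/
lemma gain_identity {K M : ℝ} (hK : 0 < K) (hM : 0 < M) {v : ℝ≥0∞} (hv : v ≤ ENNReal.ofReal M) :
    ENNReal.ofReal (2 * K * M) * gain M v + ENNReal.ofReal K * v ^ 2 =
      ENNReal.ofReal (K * M ^ 2) + ENNReal.ofReal (2 * K * M) * v := by
  have hx : v.toReal ≤ M := ENNReal.toReal_le_of_le_ofReal hM.le hv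
  have hx0 : 0 ≤ v.toReal := ENNReal.toReal_nonneg
  have hv' : v = ENNReal.ofReal v.toReal :=
    (ENNReal.ofReal_toReal (hv.trans_lt ENNReal.ofReal_lt_top).ne).symm
  rw [gain, min_eq_left hv]
  generalize v.toReal = x at hx hx0 hv'
  have hg : 0 ≤ M - (M - x) ^ 2 / (2 * M) := by
    rw [sub_nonneg, div_le_iff₀ (by positivity)]
    nlinarith
  rw [hv', ← ENNReal.ofReal_pow hx0, ← ENNReal.ofReal_mul (by positivity),
    ← ENNReal.ofReal_mul (by positivity), ← ENNReal.ofReal_mul (by positivity),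
    ← ENNReal.ofReal_add (mul_nonneg (by positivity) hg) (by positivity),
    ← ENNReal.ofReal_add (by positivity) (by positivity)]
  congr 1
  field_simp
  ring

/-- The order preserving map `y ↦ r * g(y)` on nondecreasing functions of time. -/
def picard (l : ℝ) {M : ℝ} (hM : 0 < M) : (ℝ →o ℝ≥0∞) →o (ℝ →o ℝ≥0∞) where
  toFun y := ⟨resolvent l ⋆ₗ fun t => step t * gain M (y t), monotone_lconvolution
    fun _ _ h => mul_le_mul' (monotone_step h) (monotone_gain hM (y.monotone h))⟩
  monotone' _ _ h := fun s => lconvolution_mono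
    (fun t => mul_le_mul_right (monotone_gain hM (h t)) _) s

lemma one_div_sqrt_eq_rpow {u : ℝ} (hu : 0 < u) :
    1 / √(2 * Real.pi * u) = 1 / √(2 * Real.pi) * u ^ (-(1 / 2) : ℝ) := by
  rw [Real.rpow_neg hu.le, ← Real.sqrt_eq_rpow, Real.sqrt_mul (by positivity)]
  field_simp

lemma integrableOn_one_div_sqrt (t : ℝ) :
    IntegrableOn (fun u => 1 / √(2 * Real.pi * u)) (Ioc 0 t) := by
  have hi : IntervalIntegrable (fun u => u ^ (-(1 / 2) : ℝ)) volume 0 t :=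
    intervalIntegral.intervalIntegrable_rpow' (by norm_num)
  exact (integrableOn_congr_fun (fun u hu => one_div_sqrt_eq_rpow hu.1) measurableSet_Ioc).2
    (hi.1.const_mul _)

lemma setIntegral_one_div_sqrt {t : ℝ} (ht : 0 ≤ t) :
    ∫ u in Ioc 0 t, 1 / √(2 * Real.pi * u) = √(2 * t / Real.pi) := by
  rw [setIntegral_congr_fun measurableSet_Ioc fun u hu => one_div_sqrt_eq_rpow hu.1,
    ← intervalIntegral.integral_of_le ht,
    intervalIntegral.integral_const_mul, integral_rpow (Or.inl (by norm_num)),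
    show (-(1 / 2) + 1 : ℝ) = 1 / 2 by norm_num, ← Real.sqrt_eq_rpow, ← Real.sqrt_eq_rpow,
    Real.sqrt_div (by positivity), Real.sqrt_mul (by norm_num), Real.sqrt_mul (by norm_num),
    Real.sqrt_zero, sub_zero]
  have h2 : √2 ^ 2 = 2 := Real.sq_sqrt (by norm_num)
  field_simp
  rw [h2, mul_comm]

lemma kern_lconvolution_step (t : ℝ) :
    (kern ⋆ₗ step) t = ENNReal.ofReal √(2 * t / Real.pi) := by
  rcases le_or_gt t 0 with ht | ht
  · rw [lconvolution_of_nonpos (fun _ => kern_of_nonpos) (fun _ => step_of_nonpos) ht,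
      Real.sqrt_eq_zero_of_nonpos, ENNReal.ofReal_zero]
    exact div_nonpos_of_nonpos_of_nonneg (by linarith) Real.pi_pos.le
  rw [lconvolution_def, ← setIntegral_one_div_sqrt ht.le,
    ofReal_integral_eq_lintegral_ofReal (integrableOn_one_div_sqrt t)
    (ae_of_all _ fun u => by positivity), ← lintegral_indicator measurableSet_Ioc]
  refine lintegral_congr_ae ?_
  filter_upwards [Measure.ae_ne volume t] with u hu
  rcases le_or_gt u 0 with h0 | h0
  · simp [kern_of_nonpos h0, h0]
  rcases lt_or_gt_of_ne hu with h | h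
  · rw [indicator_of_mem (show u ∈ Ioc 0 t from ⟨h0, h.le⟩), kern,
      step_of_pos (t := -u + t) (by linarith), mul_one]
  · rw [indicator_of_notMem fun hh => absurd hh.2 (not_le.2 h),
      step_of_nonpos (t := -u + t) (by linarith), mul_zero]

/-- The equation `y + K (k * y²) = θ (k * 1)` with `θ = K M²` has a nondecreasing solution bounded
by `M`, namely the least fixed point of `picard`. -/
lemma exists_lconvolution_solution {K M : ℝ} (hK : 0 < K) (hM : 0 < M) :
    ∃ y : ℝ → ℝ≥0∞, Monotone y ∧ (∀ t ≤ 0, y t = 0) ∧ (∀ t, y t ≤ ENNReal.ofReal M) ∧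
      ∀ t, y t + ENNReal.ofReal K * (kern ⋆ₗ fun u => y u ^ 2) t =
        ENNReal.ofReal (K * M ^ 2) * (kern ⋆ₗ step) t := by
  set l := 2 * K * M with hl_def
  have hl : 0 < l := by positivity
  set y := (picard l hM).lfp
  set H : ℝ → ℝ≥0∞ := fun t => step t * gain M (y t) with hH_def
  have hfix : ∀ t, y t = (resolvent l ⋆ₗ H) t := fun t =>
    (DFunLike.congr_fun (picard l hM).map_lfp t).symm
  have hy : Measurable y := y.monotone.measurable
  have hH : Measurable H := measurable_step.mul ((monotone_gain hM).measurable.comp hy)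
  have hy0 : ∀ t ≤ 0, y t = 0 := fun t ht => by
    rw [hfix, lconvolution_of_nonpos (fun _ => resolvent_of_nonpos l)
      (fun u hu => by simp [H, step_of_nonpos hu]) ht]
  have hyM : ∀ t, y t ≤ ENNReal.ofReal M := fun t => by
    calc y t ≤ (resolvent l ⋆ₗ fun u => ENNReal.ofReal M * step u) t := by
          rw [hfix]
          refine lconvolution_mono (fun u => ?_) t
          rw [mul_comm (ENNReal.ofReal M)]
          exact mul_le_mul_right (gain_le hM _) _
      _ = ENNReal.ofReal M * (resolvent l ⋆ₗ step) t :=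
          lconvolution_const_mul (by fun_prop) (by fun_prop) _ _
      _ ≤ ENNReal.ofReal M * 1 := by gcongr; exact lconvolution_resolvent_step_le hl t
      _ = _ := mul_one _
  refine ⟨y, y.monotone, hy0, hyM, fun t => ?_⟩
  have hres : y t + ENNReal.ofReal l * (kern ⋆ₗ y) t = ENNReal.ofReal l * (kern ⋆ₗ H) t := by
    have h1 : (kern ⋆ₗ y) t = ((kern ⋆ₗ resolvent l) ⋆ₗ H) t := by
      rw [← lconvolution_assoc (by fun_prop) (by fun_prop) hH]
      congr 1
      exact funext hfix
    have hm : Measurable (kern ⋆ₗ resolvent l) :=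
      measurable_lconvolution _ (by fun_prop) (by fun_prop)
    rw [h1, hfix, ← const_mul_lconvolution hm hH, ← const_mul_lconvolution (by fun_prop) hH,
      lconvolution_comm, lconvolution_comm (g := H), ← lconvolution_add hH (by fun_prop),
      lconvolution_comm]
    congr 1
    exact funext (resolvent_equation hl)
  have hsum : ENNReal.ofReal l * (kern ⋆ₗ H) t + ENNReal.ofReal K * (kern ⋆ₗ fun u => y u ^ 2) t =
      ENNReal.ofReal (K * M ^ 2) * (kern ⋆ₗ step) t + ENNReal.ofReal l * (kern ⋆ₗ y) t := by
    rw [← lconvolution_const_mul (by fun_prop) hH,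
      ← lconvolution_const_mul (by fun_prop) (by fun_prop),
      ← lconvolution_const_mul (by fun_prop) (by fun_prop),
      ← lconvolution_const_mul (by fun_prop) hy, ← lconvolution_add (by fun_prop) (by fun_prop),
      ← lconvolution_add (by fun_prop) (by fun_prop)]
    congr 1
    funext u
    rcases le_or_gt u 0 with hu | hu
    · simp [H, step_of_nonpos hu, hy0 u hu]
    · simp only [H, step_of_pos hu, one_mul, mul_one]
      exact gain_identity hK hM (hyM u)
  have hfin : ENNReal.ofReal l * (kern ⋆ₗ y) t ≠ ∞ := by
    refine ENNReal.mul_ne_top ENNReal.ofReal_ne_top (ne_top_of_le_ne_top ?_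
      (lconvolution_mono (h := fun u => ENNReal.ofReal M * step u) (fun u => ?_) t))
    · rw [lconvolution_const_mul (by fun_prop) (by fun_prop), kern_lconvolution_step]
      exact ENNReal.mul_ne_top ENNReal.ofReal_ne_top ENNReal.ofReal_ne_top
    · rcases le_or_gt u 0 with hu | hu
      · simp [hy0 u hu]
      · simpa [step_of_pos hu] using hyM u
  refine (ENNReal.add_left_inj hfin).1 ?_
  rw [← hsum, ← hres]
  ring

/-- A nondecreasing solution on `[0, ∞)`, extended by zero to `(-∞, 0]`. The substitution
`u = s - v` and the extension turn the integral into one over `ℝ` in which `s` enters only through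
`y`. -/
structure IsMonotoneSolution (K θ : ℝ) (y : ℝ → ℝ) : Prop where
  monotone : Monotone y
  eq_zero : ∀ t ≤ 0, y t = 0
  integrable : ∀ s, Integrable fun v => y (s - v) ^ 2 / √(2 * Real.pi * v)
  eqn : ∀ s, y s = √(2 * s / Real.pi) * θ - K * ∫ v, y (s - v) ^ 2 / √(2 * Real.pi * v)

lemma exists_isMonotoneSolution {K M : ℝ} (hK : 0 < K) (hM : 0 < M) :
    ∃ y : ℝ → ℝ, IsMonotoneSolution K (K * M ^ 2) y ∧ ∀ t, y t ≤ M := by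
  obtain ⟨y, hmono, hy0, hyM, hy⟩ := exists_lconvolution_solution hK hM
  have hfin : ∀ t, y t ≠ ∞ := fun t => ((hyM t).trans_lt ENNReal.ofReal_lt_top).ne
  have hmono' : Monotone fun t => (y t).toReal := fun s t h =>
    ENNReal.toReal_mono (hfin t) (hmono h)
  suffices hmain : ∀ s, Integrable (fun v => (y (s - v)).toReal ^ 2 / √(2 * Real.pi * v)) ∧
      (y s).toReal = √(2 * s / Real.pi) * (K * M ^ 2) -
        K * ∫ v, (y (s - v)).toReal ^ 2 / √(2 * Real.pi * v) from
    ⟨fun t => (y t).toReal, ⟨hmono', fun t ht => by simp [hy0 t ht], fun s => (hmain s).1,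
      fun s => (hmain s).2⟩, fun t => ENNReal.toReal_le_of_le_ofReal hM.le (hyM t)⟩
  intro s
  have hmeas : Measurable fun v => (y (s - v)).toReal ^ 2 / √(2 * Real.pi * v) := by
    have := hmono.measurable
    fun_prop
  have hnn : ∀ v, 0 ≤ (y (s - v)).toReal ^ 2 / √(2 * Real.pi * v) := fun v => by positivity
  have hlint : ∫⁻ v, ENNReal.ofReal ((y (s - v)).toReal ^ 2 / √(2 * Real.pi * v)) =
      (kern ⋆ₗ fun u => y u ^ 2) s := by
    refine lintegral_congr fun v => ?_
    rw [div_eq_mul_one_div, mul_comm, ENNReal.ofReal_mul (by positivity), kern,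
      ENNReal.ofReal_pow ENNReal.toReal_nonneg, ENNReal.ofReal_toReal (hfin _), neg_add_eq_sub]
  have hrhs : ENNReal.ofReal (K * M ^ 2) * (kern ⋆ₗ step) s ≠ ∞ := by
    rw [kern_lconvolution_step]
    exact ENNReal.mul_ne_top ENNReal.ofReal_ne_top ENNReal.ofReal_ne_top
  have hKfin : ENNReal.ofReal K * (kern ⋆ₗ fun u => y u ^ 2) s ≠ ∞ :=
    ne_top_of_le_ne_top hrhs (le_add_self.trans (hy s).le)
  have hcfin : (kern ⋆ₗ fun u => y u ^ 2) s ≠ ∞ := fun h => hKfin (by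
    rw [h, ENNReal.mul_top (by simpa using hK)])
  have hint : ∫ v, (y (s - v)).toReal ^ 2 / √(2 * Real.pi * v) =
      ((kern ⋆ₗ fun u => y u ^ 2) s).toReal := by
    rw [integral_eq_lintegral_of_nonneg_ae (ae_of_all _ hnn) hmeas.aestronglyMeasurable, hlint]
  refine ⟨⟨hmeas.aestronglyMeasurable, ?_⟩, ?_⟩
  · rw [hasFiniteIntegral_iff_ofReal (ae_of_all _ hnn), hlint]
    exact hcfin.lt_top
  · have := congrArg ENNReal.toReal (hy s)
    rw [ENNReal.toReal_add (hfin s) hKfin, ENNReal.toReal_mul, ENNReal.toReal_mul,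
      kern_lconvolution_step, ENNReal.toReal_ofReal hK.le, ENNReal.toReal_ofReal (by positivity),
      ENNReal.toReal_ofReal (by positivity)] at this
    rw [hint]
    linarith

end

/-! ### Regularity and limit of a monotone solution -/

namespace IsMonotoneSolution

variable {K θ : ℝ} {y : ℝ → ℝ}

lemma nonneg (h : IsMonotoneSolution K θ y) (t : ℝ) : 0 ≤ y t := by
  rcases le_or_gt t 0 with ht | ht
  · exact (h.eq_zero t ht).ge
  · exact (h.eq_zero 0 le_rfl).ge.trans (h.monotone ht.le)

lemma isNonnegSolutionOn (h : IsMonotoneSolution K θ y) (S : Set ℝ) :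
    IsNonnegSolutionOn K θ S y := by
  have hint : ∀ s, Integrable fun u => y u ^ 2 / √(2 * Real.pi * (s - u)) := fun s => by
    simpa using (h.integrable s).comp_sub_left s
  refine ⟨fun s _ => h.nonneg s, fun s _ => (hint s).intervalIntegrable, fun s _ => ?_⟩
  rw [intervalIntegral.integral_eq_integral_of_support_subset, h.eqn s]
  · rw [← integral_sub_left_eq_self (fun u => y u ^ 2 / √(2 * Real.pi * (s - u))) volume s]
    simp
  · refine fun u hu => ⟨not_le.1 fun h0 => hu (by simp [h.eq_zero u h0]), not_lt.1 fun hsu => hu ?_⟩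
    have : 2 * Real.pi * (s - u) ≤ 0 :=
      mul_nonpos_of_nonneg_of_nonpos (by positivity) (by linarith)
    simp [Real.sqrt_eq_zero_of_nonpos this]

/-- The integral term is nondecreasing in time, so `y` grows at most as fast as `θ √(2t/π)`. -/
lemma sub_le (h : IsMonotoneSolution K θ y) (hK : 0 ≤ K) {s t : ℝ} (hst : s ≤ t) :
    y t - y s ≤ θ * (√(2 * t / Real.pi) - √(2 * s / Real.pi)) := by
  have : ∫ v, y (s - v) ^ 2 / √(2 * Real.pi * v) ≤ ∫ v, y (t - v) ^ 2 / √(2 * Real.pi * v) :=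
    integral_mono (h.integrable s) (h.integrable t) fun v => by
      have h1 := h.nonneg (s - v)
      have h2 := h.monotone (show s - v ≤ t - v by linarith)
      dsimp only
      gcongr
  rw [h.eqn s, h.eqn t]
  linarith [mul_le_mul_of_nonneg_left this hK]

lemma le_sqrt (h : IsMonotoneSolution K θ y) (hK : 0 ≤ K) (t : ℝ) :
    y t ≤ θ * √(2 * t / Real.pi) := by
  have : 0 ≤ ∫ v, y (t - v) ^ 2 / √(2 * Real.pi * v) := integral_nonneg fun v => by positivity
  rw [h.eqn t]
  linarith [mul_nonneg hK this]

/-- In `y(t)² - y(s)² = (y(t) - y(s)) (y(t) + y(s))` the bounds on the factors combine to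
`θ² (√(2t/π) - √(2s/π)) (√(2t/π) + √(2s/π))`, which is linear in `t - s`. -/
lemma lipschitzWith_sq (h : IsMonotoneSolution K θ y) (hK : 0 ≤ K) (hθ : 0 ≤ θ) :
    LipschitzWith (Real.toNNReal (θ ^ 2 * (2 / Real.pi))) fun t => y t ^ 2 := by
  have key : ∀ s t, s ≤ t → y t ^ 2 ≤ y s ^ 2 + θ ^ 2 * (2 / Real.pi) * (t - s) := fun s t hst => by
    set a := 2 * s / Real.pi with ha
    set b := 2 * t / Real.pi with hb
    have hab : b - a = 2 / Real.pi * (t - s) := by rw [ha, hb]; ring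
    have hab' : a ≤ b := sub_nonneg.1 (hab ▸ mul_nonneg (by positivity) (by linarith))
    have hsq : √b ^ 2 - √a ^ 2 ≤ b - a := by
      rcases le_or_gt 0 a with h0 | h0
      · rw [Real.sq_sqrt h0, Real.sq_sqrt (h0.trans hab')]
      · rw [Real.sqrt_eq_zero_of_nonpos h0.le]
        rcases le_or_gt 0 b with h1 | h1
        · rw [Real.sq_sqrt h1]; linarith
        · rw [Real.sqrt_eq_zero_of_nonpos h1.le]; linarith
    have h1 := h.sub_le hK hst
    have h2 := add_le_add (h.le_sqrt hK t) (h.le_sqrt hK s)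
    have h3 : (y t - y s) * (y t + y s) ≤
        (θ * (√b - √a)) * (θ * √b + θ * √a) :=
      mul_le_mul h1 h2 (add_nonneg (h.nonneg t) (h.nonneg s))
        (mul_nonneg hθ (sub_nonneg.2 (Real.sqrt_le_sqrt hab')))
    have h4 := mul_le_mul_of_nonneg_left hsq (sq_nonneg θ)
    rw [hab] at h4
    linarith
  refine LipschitzWith.of_le_add_mul _ fun t s => ?_
  rw [Real.coe_toNNReal _ (by positivity)]
  rcases le_total s t with hst | hst
  · rw [Real.dist_eq, abs_of_nonneg (sub_nonneg.2 hst)]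
    exact key s t hst
  · have h1 : y t ^ 2 ≤ y s ^ 2 := pow_le_pow_left₀ (h.nonneg t) (h.monotone hst) 2
    have h2 : 0 ≤ θ ^ 2 * (2 / Real.pi) * dist t s := by positivity
    linarith

lemma continuous (h : IsMonotoneSolution K θ y) (hK : 0 ≤ K) (hθ : 0 ≤ θ) : Continuous y := by
  have : y = fun t => √(y t ^ 2) := funext fun t => (Real.sqrt_sq (h.nonneg t)).symm
  rw [this]
  exact (h.lipschitzWith_sq hK hθ).continuous.sqrt

/-- Differentiation under the integral sign: the Lipschitz function `y²` is differentiable almost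
everywhere. -/
lemma differentiableAt (h : IsMonotoneSolution K θ y) (hK : 0 ≤ K) (hθ : 0 ≤ θ) {s : ℝ}
    (hs : 0 < s) : DifferentiableAt ℝ y s := by
  set C := θ ^ 2 * (2 / Real.pi) with hC_def
  have hC : 0 ≤ C := by positivity
  have hlip : LipschitzWith (Real.toNNReal C) fun t => y t ^ 2 := h.lipschitzWith_sq hK hθ
  have hmeas : Measurable y := h.monotone.measurable
  have hJ := (hasDerivAt_integral_of_dominated_loc_of_lip (μ := volume) (𝕜 := ℝ)
    (F := fun t v => y (t - v) ^ 2 / √(2 * Real.pi * v))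
    (F' := fun v => deriv (fun t => y t ^ 2) (s - v) / √(2 * Real.pi * v))
    (x₀ := s) (s := Iio (s + 1))
    (bound := fun v => C * Real.exp (1 ^ 2 / 2 * (s + 1)) *
      (Real.exp (-(1 ^ 2 / 2 * v)) / √(2 * Real.pi * v)))
    (Iio_mem_nhds (by linarith))
    (.of_forall fun t => (by fun_prop : Measurable _).aestronglyMeasurable)
    (h.integrable s)
    ((((measurable_deriv _).comp (measurable_const.sub measurable_id)).div
      (by fun_prop)).aestronglyMeasurable)
    (ae_of_all _ fun v => ?_) ((integrable_exp_div_sqrt one_pos).const_mul _) ?_).2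
  · have heq : y = fun t => √(2 * t / Real.pi) * θ -
        K * ∫ v, y (t - v) ^ 2 / √(2 * Real.pi * v) := funext h.eqn
    rw [heq]
    refine DifferentiableAt.sub (DifferentiableAt.mul_const (DifferentiableAt.sqrt ?_ ?_) _)
      (hJ.differentiableAt.const_mul K)
    · fun_prop
    · positivity
  -- For `v ≤ s + 1` the exponential factors are at least one; for `v > s + 1` and `t < s + 1` the
  -- integrand vanishes, since `y = 0` on the negative half line. The factor `exp(-v / 2)` makes the
  -- bound integrable on `ℝ`.
  · refine LipschitzOnWith.of_dist_le_mul fun t ht t' ht' => ?_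
    refine le_trans ?_ (mul_le_mul_of_nonneg_right (le_abs_self _) dist_nonneg)
    rw [Real.dist_eq]
    rcases le_or_gt v (s + 1) with hv | hv
    · have h1 : |y (t - v) ^ 2 - y (t' - v) ^ 2| ≤ C * dist t t' := by
        have := hlip.dist_le_mul (t - v) (t' - v)
        rwa [Real.coe_toNNReal _ hC, dist_sub_right, Real.dist_eq] at this
      have h2 : 1 ≤ Real.exp (1 ^ 2 / 2 * (s + 1)) * Real.exp (-(1 ^ 2 / 2 * v)) := by
        rw [← Real.exp_add]
        exact Real.one_le_exp (by linarith)
      calc |y (t - v) ^ 2 / √(2 * Real.pi * v) - y (t' - v) ^ 2 / √(2 * Real.pi * v)|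
          = |y (t - v) ^ 2 - y (t' - v) ^ 2| / √(2 * Real.pi * v) * 1 := by
            rw [← sub_div, abs_div, abs_of_nonneg (Real.sqrt_nonneg _), mul_one]
        _ ≤ C * dist t t' / √(2 * Real.pi * v) *
            (Real.exp (1 ^ 2 / 2 * (s + 1)) * Real.exp (-(1 ^ 2 / 2 * v))) := by gcongr
        _ = _ := by ring
    · rw [h.eq_zero (t - v) (by linarith [mem_Iio.1 ht]),
        h.eq_zero (t' - v) (by linarith [mem_Iio.1 ht'])]
      simp only [sub_self, abs_zero]
      positivity
  · have := (Measure.measurePreserving_sub_left volume s).quasiMeasurePreserving.ae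
      hlip.ae_differentiableAt_of_real
    filter_upwards [this] with v hv
    exact (hv.hasDerivAt.comp_sub_const s v).div_const _

lemma tendsto_atTop (h : IsMonotoneSolution K 1 y) (hK : 0 < K) (hM : ∀ t, y t ≤ 1 / √K) :
    Tendsto y atTop (𝓝 (1 / √K)) := by
  have hbdd : BddAbove (range y) := ⟨_, by rintro _ ⟨t, rfl⟩; exact hM t⟩
  have hlim := tendsto_atTop_ciSup h.monotone hbdd
  set L := ⨆ t, y t
  have hL0 : 0 ≤ L := (h.nonneg 0).trans (le_ciSup hbdd 0)
  have hLM : L ≤ 1 / √K := ciSup_le hM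
  have hle : ∀ s, 0 ≤ s → √(2 * s / Real.pi) * (1 - K * L ^ 2) ≤ 1 / √K := fun s hs => by
    have hint : ∫ v, y (s - v) ^ 2 / √(2 * Real.pi * v) ≤ L ^ 2 * √(2 * s / Real.pi) := by
      rw [← setIntegral_one_div_sqrt hs, ← integral_const_mul,
        ← integral_indicator measurableSet_Ioc]
      refine integral_mono (h.integrable s) ((integrable_indicator_iff measurableSet_Ioc).2
        ((integrableOn_one_div_sqrt s).const_mul _)) fun v => ?_
      by_cases hv : v ∈ Ioc 0 s
      · rw [indicator_of_mem hv, mul_one_div]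
        have := h.nonneg (s - v)
        have := le_ciSup hbdd (s - v)
        dsimp only
        gcongr
      · rw [indicator_of_notMem hv]
        refine le_of_eq ?_
        rcases le_or_gt v 0 with h0 | h0
        · have : 2 * Real.pi * v ≤ 0 := mul_nonpos_of_nonneg_of_nonpos (by positivity) h0
          simp [Real.sqrt_eq_zero_of_nonpos this]
        · simp [h.eq_zero (s - v) (by linarith [not_le.1 fun hvs => hv ⟨h0, hvs⟩])]
    have := hM s
    rw [h.eqn s] at this
    linarith [mul_le_mul_of_nonneg_left hint hK.le]
  have hKL : 1 ≤ K * L ^ 2 := by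
    by_contra! hlt
    have hpos : 0 < 1 - K * L ^ 2 := by linarith
    -- at the time with `√(2s/π) = N` the lower bound `hle` is `1 / √K + 1`, too large
    set N := (1 / √K + 1) / (1 - K * L ^ 2) with hN
    have h0 : 0 ≤ N := by positivity
    have := hle (Real.pi * N ^ 2 / 2) (by positivity)
    rw [show 2 * (Real.pi * N ^ 2 / 2) / Real.pi = N ^ 2 by field_simp, Real.sqrt_sq h0, hN,
      div_mul_cancel₀ _ hpos.ne'] at this
    linarith
  have hML : 1 / √K ≤ L := by
    rw [div_le_iff₀ (by positivity)]
    have : (L * √K) ^ 2 = K * L ^ 2 := by rw [mul_pow, Real.sq_sqrt hK.le, mul_comm]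
    exact (one_le_sq_iff₀ (by positivity)).1 (this ▸ hKL)
  rwa [le_antisymm hLM hML] at hlim

end IsMonotoneSolution

/-! ### Uniqueness and scaling -/

lemma le_sqrt_of_isNonnegSolutionOn {K θ : ℝ} (hK : 0 ≤ K) {S : Set ℝ} {y : ℝ → ℝ}
    (hy : IsNonnegSolutionOn K θ S y) {s : ℝ} (hs : s ∈ S) (hs0 : 0 ≤ s) :
    y s ≤ √(2 * s / Real.pi) * θ := by
  have : 0 ≤ ∫ u in (0 : ℝ)..s, y u ^ 2 / √(2 * Real.pi * (s - u)) :=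
    intervalIntegral.integral_nonneg hs0 fun u _ => by positivity
  rw [hy.eqn s hs]
  linarith [mul_nonneg hK this]

lemma intervalIntegral_exp_div_sqrt_le {l : ℝ} (hl : 0 < l) {s : ℝ} (hs : 0 ≤ s) :
    ∫ u in (0 : ℝ)..s, Real.exp (-(l ^ 2 / 2 * (s - u))) / √(2 * Real.pi * (s - u)) ≤ 1 / l := by
  rw [← integral_exp_div_sqrt hl, intervalIntegral.integral_comp_sub_left
    (fun t => Real.exp (-(l ^ 2 / 2 * t)) / √(2 * Real.pi * t)) s, sub_self, sub_zero,
    intervalIntegral.integral_of_le hs]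
  exact setIntegral_le_integral (integrable_exp_div_sqrt hl) (ae_of_all _ fun t => by positivity)

/-- In the weighted norm `S = sup |y(s) - z(s)| exp(-l² s / 2)` the equation gives `S ≤ S / 2`. -/
theorem eqOn_of_isNonnegSolutionOn {K θ T : ℝ} (hK : 0 ≤ K) (hθ : 0 ≤ θ) {y z : ℝ → ℝ}
    (hy : IsNonnegSolutionOn K θ (Icc 0 T) y) (hz : IsNonnegSolutionOn K θ (Icc 0 T) z) :
    EqOn y z (Icc 0 T) := by
  rcases lt_or_ge T 0 with hT | hT
  · simp [Icc_eq_empty (not_le.2 hT)]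
  set M := √(2 * T / Real.pi) * θ with hM_def
  have hM : 0 ≤ M := by positivity
  have hbound : ∀ {x : ℝ → ℝ}, IsNonnegSolutionOn K θ (Icc 0 T) x → ∀ s ∈ Icc 0 T, x s ≤ M :=
    fun hx s hs => (le_sqrt_of_isNonnegSolutionOn hK hx hs hs.1).trans (by
      rw [hM_def]
      have := hs.2
      gcongr)
  -- the weighted norm with this `l` makes the difference of the integral terms contract by `1/2`
  set l := 4 * K * M + 1 with hl_def
  have hl : 0 < l := by positivity
  set d : ℝ → ℝ := fun s => |y s - z s| * Real.exp (-(l ^ 2 / 2 * s)) with hd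
  have hdM : ∀ s ∈ Icc 0 T, d s ≤ M := fun s hs => by
    have h1 : |y s - z s| ≤ M := abs_sub_le_of_nonneg_of_le (hy.nonneg s hs) (hbound hy s hs)
      (hz.nonneg s hs) (hbound hz s hs)
    have h2 : Real.exp (-(l ^ 2 / 2 * s)) ≤ 1 :=
      Real.exp_le_one_iff.2 (neg_nonpos.2 (mul_nonneg (by positivity) hs.1))
    exact (mul_le_of_le_one_right (abs_nonneg _) h2).trans h1
  have hbdd : BddAbove (d '' Icc 0 T) := ⟨M, by rintro _ ⟨s, hs, rfl⟩; exact hdM s hs⟩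
  have hne : (d '' Icc 0 T).Nonempty := ⟨_, 0, left_mem_Icc.2 hT, rfl⟩
  set S := sSup (d '' Icc 0 T)
  have hdS : ∀ s ∈ Icc 0 T, d s ≤ S := fun s hs => le_csSup hbdd ⟨s, hs, rfl⟩
  have hS0 : 0 ≤ S := le_trans (by positivity) (hdS 0 (left_mem_Icc.2 hT))
  have hhalf : ∀ s ∈ Icc 0 T, d s ≤ S / 2 := fun s hs => by
    have hint : |∫ u in (0 : ℝ)..s, (z u ^ 2 / √(2 * Real.pi * (s - u)) -
        y u ^ 2 / √(2 * Real.pi * (s - u)))| ≤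
        ∫ u in (0 : ℝ)..s, 2 * M * S * Real.exp (l ^ 2 / 2 * s) *
          (Real.exp (-(l ^ 2 / 2 * (s - u))) / √(2 * Real.pi * (s - u))) := by
      rw [← Real.norm_eq_abs]
      refine intervalIntegral.norm_integral_le_of_norm_le hs.1 (ae_of_all _ fun u hu => ?_)
        ((((integrable_exp_div_sqrt hl).comp_sub_left s).const_mul _).intervalIntegrable)
      have hu' : u ∈ Icc 0 T := ⟨hu.1.le, hu.2.trans hs.2⟩
      have h1 : |y u - z u| ≤ S * Real.exp (l ^ 2 / 2 * u) := by
        have := hdS u hu'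
        rw [hd] at this
        dsimp only at this
        rwa [Real.exp_neg, ← div_eq_mul_inv, div_le_iff₀ (Real.exp_pos _)] at this
      have h2 : |y u + z u| ≤ 2 * M := by
        rw [abs_of_nonneg (add_nonneg (hy.nonneg u hu') (hz.nonneg u hu'))]
        linarith [hbound hy u hu', hbound hz u hu']
      calc ‖z u ^ 2 / √(2 * Real.pi * (s - u)) - y u ^ 2 / √(2 * Real.pi * (s - u))‖
          = |y u + z u| * |y u - z u| / √(2 * Real.pi * (s - u)) := by
            rw [← sub_div, norm_div, Real.norm_of_nonneg (Real.sqrt_nonneg _), ← abs_mul,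
              Real.norm_eq_abs, abs_sub_comm]
            congr 2; ring
        _ ≤ 2 * M * (S * Real.exp (l ^ 2 / 2 * u)) / √(2 * Real.pi * (s - u)) := by gcongr
        _ = _ := by
            have : Real.exp (l ^ 2 / 2 * u) =
                Real.exp (l ^ 2 / 2 * s) * Real.exp (-(l ^ 2 / 2 * (s - u))) := by
              rw [← Real.exp_add]; congr 1; ring
            rw [this]; ring
    rw [intervalIntegral.integral_const_mul,
      intervalIntegral.integral_sub (hz.integrable s hs) (hy.integrable s hs)] at hint
    have hle := hint.trans (mul_le_mul_of_nonneg_left (intervalIntegral_exp_div_sqrt_le hl hs.1)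
      (by positivity))
    have hyz : |y s - z s| ≤ K * (2 * M * S * Real.exp (l ^ 2 / 2 * s) * (1 / l)) := by
      refine le_trans (le_of_eq ?_) (mul_le_mul_of_nonneg_left hle hK)
      rw [hy.eqn s hs, hz.eqn s hs, ← abs_of_nonneg hK, ← abs_mul, abs_of_nonneg hK]
      congr 1; ring
    have hl' : 2 * K * M / l ≤ 1 / 2 := by
      rw [div_le_iff₀ hl]; linarith
    calc d s ≤ K * (2 * M * S * Real.exp (l ^ 2 / 2 * s) * (1 / l)) *
          Real.exp (-(l ^ 2 / 2 * s)) := mul_le_mul_of_nonneg_right hyz (Real.exp_pos _).le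
      _ = 2 * K * M / l * S * (Real.exp (l ^ 2 / 2 * s) * Real.exp (-(l ^ 2 / 2 * s))) := by ring
      _ = 2 * K * M / l * S := by rw [← Real.exp_add, add_neg_cancel, Real.exp_zero, mul_one]
      _ ≤ 1 / 2 * S := by gcongr
      _ = S / 2 := by ring
  have hS : S ≤ S / 2 := csSup_le hne (by rintro _ ⟨s, hs, rfl⟩; exact hhalf s hs)
  intro s hs
  have h0 : |y s - z s| * Real.exp (-(l ^ 2 / 2 * s)) ≤ 0 := (hdS s hs).trans (by linarith)
  have := nonpos_of_mul_nonpos_left h0 (Real.exp_pos _)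
  exact sub_eq_zero.1 (abs_nonpos_iff.1 this)

lemma _root_.IsNonnegSolutionOn.mono {K θ : ℝ} {S S' : Set ℝ} {y : ℝ → ℝ}
    (hy : IsNonnegSolutionOn K θ S y) (h : S' ⊆ S) : IsNonnegSolutionOn K θ S' y :=
  ⟨fun s hs => hy.nonneg s (h hs), fun s hs => hy.integrable s (h hs),
    fun s hs => hy.eqn s (h hs)⟩

theorem eqOn_Ici_of_isNonnegSolutionOn {K θ : ℝ} (hK : 0 ≤ K) (hθ : 0 ≤ θ) {y z : ℝ → ℝ}
    (hy : IsNonnegSolutionOn K θ (Ici 0) y) (hz : IsNonnegSolutionOn K θ (Ici 0) z) :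
    EqOn y z (Ici 0) := fun s hs =>
  eqOn_of_isNonnegSolutionOn (T := s) hK hθ (hy.mono Icc_subset_Ici_self)
    (hz.mono Icc_subset_Ici_self) (right_mem_Icc.2 hs)

/-- If `y` solves the equation with parameter `θ`, then `√c y(c ·)` solves it with parameter
`θ c`. -/
lemma isNonnegSolutionOn_scale {K θ c : ℝ} (hc : 0 < c) {y : ℝ → ℝ}
    (hy : IsNonnegSolutionOn K θ (Ici 0) y) :
    IsNonnegSolutionOn K (θ * c) (Ici 0) fun r => √c * y (c * r) := by
  have hmem : ∀ {r : ℝ}, r ∈ Ici (0 : ℝ) → c * r ∈ Ici (0 : ℝ) := fun hr =>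
    mul_nonneg hc.le hr
  have hcc : √c ^ 2 = c := Real.sq_sqrt hc.le
  have hc' : 0 < √c := Real.sqrt_pos.2 hc
  have hfun : ∀ r, (fun u => (√c * y (c * u)) ^ 2 / √(2 * Real.pi * (r - u))) = fun u =>
      c * √c * (y (c * u) ^ 2 / √(2 * Real.pi * (c * r - c * u))) := fun r => funext fun u => by
    rw [show 2 * Real.pi * (c * r - c * u) = c * (2 * Real.pi * (r - u)) by ring,
      Real.sqrt_mul hc.le, mul_pow, hcc]
    field_simp
  refine ⟨fun r hr => mul_nonneg hc'.le (hy.nonneg _ (hmem hr)), fun r hr => ?_, fun r hr => ?_⟩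
  · rw [hfun]
    have := (hy.integrable _ (hmem hr)).comp_mul_left (c := c)
    rw [zero_div, mul_div_cancel_left₀ _ hc.ne'] at this
    exact this.const_mul _
  · rw [hfun, intervalIntegral.integral_const_mul, intervalIntegral.integral_comp_mul_left
      (fun u => y u ^ 2 / √(2 * Real.pi * (c * r - u))) hc.ne', mul_zero, hy.eqn _ (hmem hr),
      show 2 * (c * r) / Real.pi = c * (2 * r / Real.pi) by ring, Real.sqrt_mul hc.le, smul_eq_mul]
    have : c * √c * (c⁻¹ * ∫ u in (0 : ℝ)..c * r, y u ^ 2 / √(2 * Real.pi * (c * r - u))) =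
        √c * ∫ u in (0 : ℝ)..c * r, y u ^ 2 / √(2 * Real.pi * (c * r - u)) := by
      field_simp
    rw [this]
    linear_combination √(2 * r / Real.pi) * θ * hcc

end SqrtVolterra

theorem theorem2p3 (K : ℝ) (hK : 0 < K) :
    ∃ Λ : ℝ → ℝ → ℝ,
      -- `Λ(·,θ)` is the unique nonnegative solution on `[0,1]`; its regularity, and the bound
      (∀ θ : ℝ, 0 < θ →
        IsNonnegSolutionOn K θ (Icc 0 1) (fun s => Λ s θ) ∧
        (∀ y : ℝ → ℝ, IsNonnegSolutionOn K θ (Icc 0 1) y →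
          EqOn y (fun s => Λ s θ) (Icc 0 1)) ∧
        ContinuousOn (fun s => Λ s θ) (Icc 0 1) ∧
        DifferentiableOn ℝ (fun s => Λ s θ) (Ioc 0 1) ∧
        MonotoneOn (fun s => Λ s θ) (Icc 0 1) ∧
        (∀ s ∈ Icc (0 : ℝ) 1, Λ s θ ≤ √(θ / K))) ∧
      -- the extension `Λ'` of `Λ` to `[0,∞)`
      ∃ Λ' : ℝ → ℝ → ℝ,
        (∀ θ : ℝ, 0 < θ →
          EqOn (fun s => Λ' s θ) (fun s => Λ s θ) (Icc 0 1) ∧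
          ContinuousOn (fun s => Λ' s θ) (Ici 0) ∧
          MonotoneOn (fun s => Λ' s θ) (Ici 0) ∧
          IsNonnegSolutionOn K θ (Ici 0) (fun s => Λ' s θ) ∧
          (∀ y : ℝ → ℝ, IsNonnegSolutionOn K θ (Ici 0) y → MonotoneOn y (Ici 0) →
            EqOn y (fun s => Λ' s θ) (Ici 0))) ∧
        (∀ s θ : ℝ, 0 < s → 0 < θ → Λ' s θ = 1 / √s * Λ' 1 (θ * s)) ∧
        Tendsto (fun s => Λ' s 1) atTop (𝓝 (1 / √K)) := by
  have hex : ∀ θ : ℝ, 0 < θ → ∃ y : ℝ → ℝ,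
      SqrtVolterra.IsMonotoneSolution K θ y ∧ ∀ t, y t ≤ √(θ / K) := by
    intro θ hθ
    have := SqrtVolterra.exists_isMonotoneSolution hK (M := √(θ / K)) (by positivity)
    rwa [Real.sq_sqrt (by positivity), mul_div_cancel₀ _ hK.ne'] at this
  choose! Y hY hYle using hex
  refine ⟨fun s θ => Y θ s, fun θ hθ => ?_, fun s θ => Y θ s, fun θ hθ => ?_, ?_, ?_⟩
  · have h := hY θ hθ
    exact ⟨h.isNonnegSolutionOn _, fun y hy =>
      SqrtVolterra.eqOn_of_isNonnegSolutionOn hK.le hθ.le hy (h.isNonnegSolutionOn _),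
      (h.continuous hK.le hθ.le).continuousOn, fun s hs =>
      (h.differentiableAt hK.le hθ.le hs.1).differentiableWithinAt, h.monotone.monotoneOn _,
      fun s _ => hYle θ hθ s⟩
  · have h := hY θ hθ
    exact ⟨fun _ _ => rfl, (h.continuous hK.le hθ.le).continuousOn, h.monotone.monotoneOn _,
      h.isNonnegSolutionOn _, fun y hy _ =>
      SqrtVolterra.eqOn_Ici_of_isNonnegSolutionOn hK.le hθ.le hy (h.isNonnegSolutionOn _)⟩
  · intro s θ hs hθ
    have hθs : 0 < θ * s := mul_pos hθ hs
    have := SqrtVolterra.eqOn_Ici_of_isNonnegSolutionOn hK.le hθs.le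
      ((hY (θ * s) hθs).isNonnegSolutionOn _)
      (SqrtVolterra.isNonnegSolutionOn_scale hs ((hY θ hθ).isNonnegSolutionOn _))
      (mem_Ici.2 zero_le_one)
    simp only [mul_one] at this
    dsimp only
    rw [this]
    field_simp
  · refine (hY 1 one_pos).tendsto_atTop hK fun t => ?_
    simpa using hYle 1 one_pos t
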